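/- Let $X$ be a real ordered vector space (with a partial order compatible with the linear structure). Suppose that - $X$ is Archimedean: if $x,y\in X$ and $nx\le y$ for all $n\in\mathbb{N}$, then $x\le 0$; - $X$ is a pre-Riesz space: for all $x,y,z\in X$, if every upper bound of $\{x+y,x+z\}$ is an upper bound of $\{y,z\}$, then $x\ge 0$; - $X$ has an order unit: there is $e\ge 0$ in $X$ such that for every $x\in X$ there is a real $c>0$ with $-ce\le x\le ce$. Let $C(\Omega)$ denote the space of real continuous functions on $\Omega$ with the pointwise order. Then there exist a compact Hausdorff space $\Omega$ and a linear map $i\colon X\to C(\Omega)$ which is bipositive (that is, $x\ge 0$ if and only if $i(x)\ge 0$) and whose image is order dense in $C(\Omega)$, i.e. $f=\inf\{d\in i(X): d\ge f\}$ (infimum in $C(\Omega)$) for every $f\in C(\Omega)$. Moreover, for every compact Hausdorff space $\Omega$ and every bipositive linear map $i\colon X\to C(\Omega)$ with order dense image (in particular for the one just obtained), and for every positive linear functional $\phi\colon X\to\mathbb{R}$, there exists a regular (positive) Borel measure $\mu$ on $\Omega$ such that $$\phi(x)=\int_\Omega i(x)(\omega)\,d\mu(\omega)\qquad\text{for all }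 x\in X.$$ (For $X=\{0\}$ the space $\Omega$ is empty.) -/

import Mathlib

open MeasureTheory

universe u v

/-- An ordered vector space is Archimedean if `n x ≤ y` for all `n` forces `x ≤ 0`.
(Whether or not `n = 0` is included is immaterial: replace `y` by `y - x`.) -/
def IsArchimedeanOVS (X : Type*) [AddCommGroup X] [PartialOrder X] : Prop :=
  ∀ x y : X, (∀ n : ℕ, n • x ≤ y) → x ≤ 0

/-- A pre-Riesz space: whenever every upper bound of `{x + y, x + z}` is an upper bound of
`{y, z}`, the vector `x` is positive. -/
def IsPreRiesz (X : Type*) [AddCommGroup X] [PartialOrder X] : Prop :=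
  ∀ x y z : X, upperBounds {x + y, x + z} ⊆ upperBounds {y, z} → 0 ≤ x

/-- `e` is an order unit: `e` is positive and every vector lies in some `[-c e, c e]`, `c > 0`. -/
def IsOrderUnit {X : Type*} [AddCommGroup X] [PartialOrder X] [Module ℝ X] (e : X) : Prop :=
  0 ≤ e ∧ ∀ x : X, ∃ c : ℝ, 0 < c ∧ -(c • e) ≤ x ∧ x ≤ c • e

/-- A linear subspace `D` is order dense in `Y` if every `y : Y` is the infimum of the elements of
`D` that lie above `y`. -/
def IsOrderDense {Y : Type*} [AddCommGroup Y] [PartialOrder Y] [Module ℝ Y]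
    (D : Submodule ℝ Y) : Prop :=
  ∀ y : Y, IsGLB {d : Y | d ∈ D ∧ y ≤ d} y

/-- A linear map is bipositive if `x` is positive exactly when its image is. -/
def IsBipositive {X Y : Type*} [AddCommGroup X] [PartialOrder X] [Module ℝ X]
    [AddCommGroup Y] [PartialOrder Y] [Module ℝ Y] (i : X →ₗ[ℝ] Y) : Prop :=
  ∀ x : X, 0 ≤ x ↔ 0 ≤ i x

/-! The representing space is the closure of the pure states, i.e. the extreme points of the set of
states, under pointwise convergence. Hahn-Banach and the Archimedean property show that states
detect positivity, and Krein-Milman reduces this to pure states, so evaluation is bipositive.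

Order density rests on uniqueness. Extremality makes any positive extension of a pure state to `C(Ω,
ℝ)` multiplicative against the image of `X`, and Stone-Weierstrass then forces it to be point
evaluation. Since `exists_positive_extension` can make the value at `f` as large as the majorants of
`f` permit, no lower bound of these majorants exceeds `f` at a pure state.

For the measure, an order dense image is majorizing, so a positive functional extends to `C(Ω, ℝ)`,
where Riesz-Markov-Kakutani applies. -/

/-- A positive functional on the domain of a majorizing map `i` factors through a positive
functional `ψ` on the codomain, and `ψ v` can be made at least any lower bound for the values of the
functional on the vectors whose image dominates `v`. -/
theorem exists_positive_extension {X Y : Type*} [AddCommGroup X] [Module ℝ X]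
    [AddCommGroup Y] [PartialOrder Y] [IsOrderedAddMonoid Y] [Module ℝ Y] [IsOrderedModule ℝ Y]
    (i : X →ₗ[ℝ] Y) (hmaj : ∀ y, ∃ x, y ≤ i x) (φ : X →ₗ[ℝ] ℝ) (hφ : ∀ x, 0 ≤ i x → 0 ≤ φ x)
    (v : Y) (c : ℝ) (hc : ∀ x, v ≤ i x → c ≤ φ x) :
    ∃ ψ : Y →ₗ[ℝ] ℝ, (∀ y, 0 ≤ y → 0 ≤ ψ y) ∧ (∀ x, ψ (i x) = φ x) ∧ c ≤ ψ v := by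
  let S : Y → Set ℝ := fun y => {t | ∃ x, y ≤ i x ∧ φ x = t}
  -- A linear `ψ ≤ N` is automatically positive and extends `φ`: compare at `-y` and at `i (±x)`.
  -- Prescribing `N v` at `v` gives `ψ v` its largest possible value.
  let N : Y → ℝ := fun y => sInf (S y)
  have hne : ∀ y, (S y).Nonempty := fun y => by
    obtain ⟨x, hx⟩ := hmaj y
    exact ⟨φ x, x, hx, rfl⟩
  have hbdd : ∀ y, BddBelow (S y) := fun y => by
    obtain ⟨x₁, hx₁⟩ := hmaj (-y)
    refine ⟨-φ x₁, ?_⟩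
    rintro _ ⟨x, hx, rfl⟩
    have := hφ (x + x₁) (by
      rw [map_add]
      calc (0 : Y) = y + -y := by simp
        _ ≤ _ := add_le_add hx hx₁)
    rw [map_add] at this
    linarith
  have hle : ∀ y x, y ≤ i x → N y ≤ φ x := fun y x hx => csInf_le (hbdd y) ⟨x, hx, rfl⟩
  have hlb : ∀ y b, (∀ x, y ≤ i x → b ≤ φ x) → b ≤ N y := fun y b hb =>
    le_csInf (hne y) (by rintro _ ⟨x, hx, rfl⟩; exact hb x hx)
  have hhom' : ∀ c : ℝ, 0 < c → ∀ y, c * N y ≤ N (c • y) := fun c hc y => by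
    refine hlb _ _ fun x hx => ?_
    have h1 : y ≤ i (c⁻¹ • x) := by
      have := smul_le_smul_of_nonneg_left hx (inv_nonneg.2 hc.le)
      rwa [smul_smul, inv_mul_cancel₀ hc.ne', one_smul, ← map_smul] at this
    have h2 := mul_le_mul_of_nonneg_left (hle _ _ h1) hc.le
    rwa [map_smul, smul_eq_mul, mul_inv_cancel_left₀ hc.ne'] at h2
  have hhom : ∀ c : ℝ, 0 < c → ∀ y, N (c • y) = c * N y := fun c hc y => by
    refine le_antisymm ?_ (hhom' c hc y)
    have := mul_le_mul_of_nonneg_left (hhom' c⁻¹ (inv_pos.2 hc) (c • y)) hc.le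
    rwa [mul_inv_cancel_left₀ hc.ne', smul_smul, inv_mul_cancel₀ hc.ne', one_smul] at this
  have hadd : ∀ x y, N (x + y) ≤ N x + N y := fun x y => by
    rw [← sub_le_iff_le_add]
    refine hlb _ _ fun b hb => ?_
    rw [sub_le_comm]
    refine hlb _ _ fun a ha => ?_
    have := hle (x + y) (b + a) (by rw [map_add]; exact add_le_add hb ha)
    rw [map_add] at this
    linarith
  have hv0 : ∀ a : ℝ, a • v = 0 → a • N v = 0 := fun a ha => by
    rcases smul_eq_zero.1 ha with rfl | h
    · simp
    · have := hhom 2 two_pos 0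
      rw [smul_zero] at this
      rw [h, smul_eq_mul, show N 0 = 0 by linarith, mul_zero]
  have hN0 : N 0 = 0 := by
    have := hhom 2 two_pos 0
    rw [smul_zero] at this
    linarith
  obtain ⟨ψ, hψ, hψN⟩ := exists_extension_of_le_sublinear
    (LinearPMap.mkSpanSingleton' v (N v) hv0) N hhom hadd (by
      rintro ⟨y, hy⟩
      obtain ⟨a, rfl⟩ := Submodule.mem_span_singleton.1 hy
      rw [LinearPMap.mkSpanSingleton'_apply, smul_eq_mul]
      change a * N v ≤ N (a • v)
      rcases lt_trichotomy a 0 with h | rfl | h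
      · have h1 := hhom (-a) (by linarith) v
        have h2 := hadd (a • v) (-a • v)
        rw [neg_smul, add_neg_cancel, ← neg_smul, h1, hN0] at h2
        linarith
      · simp [hN0]
      · exact (hhom a h v).ge)
  have hψi : ∀ x, ψ (i x) ≤ φ x := fun x => (hψN _).trans (hle _ _ le_rfl)
  refine ⟨ψ, fun y hy => ?_, fun x => (hψi x).antisymm ?_, ?_⟩
  · have h1 := (hψN (-y)).trans (hle (-y) 0 (by simpa using hy))
    simp only [map_neg, map_zero] at h1
    linarith
  · have := hψi (-x)
    simp only [map_neg] at this
    linarith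
  · have h1 := hψ ⟨v, Submodule.mem_span_singleton_self v⟩
    have h2 := LinearPMap.mkSpanSingleton'_apply_self (σ := RingHom.id ℝ) v (N v) hv0
      (Submodule.mem_span_singleton_self v)
    exact (hlb v c hc).trans (h2.symm.trans h1.symm).le

/-- A positive functional on `C(Ω, ℝ)`, `Ω` compact, is integration against a regular measure. -/
theorem exists_regular_measure_of_positive {Ω : Type*} [TopologicalSpace Ω] [CompactSpace Ω]
    [T2Space Ω] [MeasurableSpace Ω] [BorelSpace Ω] (ψ : C(Ω, ℝ) →ₗ[ℝ] ℝ)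
    (hψ : ∀ f, 0 ≤ f → 0 ≤ ψ f) :
    ∃ μ : Measure Ω, μ.Regular ∧ ∀ f : C(Ω, ℝ), ψ f = ∫ ω, f ω ∂μ := by
  let Λ : CompactlySupportedContinuousMap Ω ℝ →ₚ[ℝ] ℝ :=
    { toFun := fun f => ψ f.toContinuousMap
      map_add' := fun f g => map_add ψ f.toContinuousMap g.toContinuousMap
      map_smul' := fun c f => map_smul ψ c f.toContinuousMap
      monotone' := fun f g hfg => by
        have h := hψ (g.toContinuousMap - f.toContinuousMap) (sub_nonneg.2 fun ω => hfg ω)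
        rw [map_sub] at h
        exact sub_nonneg.1 h }
  refine ⟨RealRMK.rieszMeasure Λ, inferInstance, fun f => ?_⟩
  exact (RealRMK.integral_rieszMeasure Λ ⟨f, HasCompactSupport.of_compactSpace _⟩).symm

/-- An order dense subspace of `C(Ω, ℝ)` is majorizing. -/
theorem IsOrderDense.exists_le {Ω : Type*} [TopologicalSpace Ω]
    {D : Submodule ℝ C(Ω, ℝ)} (hD : IsOrderDense D) (f : C(Ω, ℝ)) : ∃ d ∈ D, f ≤ d := by
  by_contra! h
  -- With no majorant, `f + 1` is vacuously a lower bound. On empty `Ω` this is no contradiction in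
  -- itself, but then `0` majorizes `f`.
  have h1 : f + 1 ≤ f := (hD f).2 fun d hd => (h d hd.1 hd.2).elim
  refine h 0 D.zero_mem fun ω => ?_
  have h2 : f ω + 1 ≤ f ω := h1 ω
  linarith

/-! ### The state space and detection of positivity -/

section States

variable {X : Type*} [AddCommGroup X] [PartialOrder X] [Module ℝ X]

/-- The positive linear functionals taking the value one at `e`. -/
def states (e : X) : Set (X → ℝ) :=
  {f | ∃ φ : X →ₗ[ℝ] ℝ, (∀ x, 0 ≤ x → 0 ≤ φ x) ∧ φ e = 1 ∧ ⇑φ = f}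

theorem convex_states (e : X) : Convex ℝ (states e) := by
  rintro _ ⟨φ, hφ, hφe, rfl⟩ _ ⟨χ, hχ, hχe, rfl⟩ a b ha hb hab
  refine ⟨a • φ + b • χ, fun x hx => ?_, ?_, rfl⟩
  · exact add_nonneg (mul_nonneg ha (hφ x hx)) (mul_nonneg hb (hχ x hx))
  · simpa [hφe, hχe] using hab

variable [IsOrderedAddMonoid X] {e : X}

/-- The order unit confines each coordinate to a bounded interval, so Tychonoff applies. -/
theorem isCompact_states (he : IsOrderUnit e) : IsCompact (states e) := by
  choose c hc hl hu using he.2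
  have hsub : states e ⊆ Set.univ.pi fun x => Set.Icc (-c x) (c x) := by
    rintro _ ⟨φ, hφ, hφe, rfl⟩ x -
    have h1 := hφ _ (sub_nonneg.2 (hl x))
    have h2 := hφ _ (sub_nonneg.2 (hu x))
    simp only [map_sub, map_neg, map_smul, hφe, smul_eq_mul, mul_one] at h1 h2
    constructor <;> linarith
  have hcl : IsClosed (states e) := by
    have : states e = Set.range ((↑) : (X →ₗ[ℝ] ℝ) → X → ℝ) ∩
        ((⋂ x ∈ {x : X | 0 ≤ x}, {f : X → ℝ | 0 ≤ f x}) ∩ {f : X → ℝ | f e = 1}) := by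
      ext f
      simp only [Set.mem_inter_iff, Set.mem_iInter, Set.mem_range]
      constructor
      · rintro ⟨φ, hφ, hφe, rfl⟩
        exact ⟨⟨φ, rfl⟩, hφ, hφe⟩
      · rintro ⟨⟨φ, rfl⟩, hφ, hφe⟩
        exact ⟨φ, hφ, hφe, rfl⟩
    rw [this]
    refine (LinearMap.isClosed_range_coe X ℝ (RingHom.id ℝ)).inter (.inter ?_ ?_)
    · exact isClosed_biInter fun x _ => isClosed_le continuous_const (continuous_apply x)
    · exact isClosed_eq (continuous_apply e) continuous_const
  exact (isCompact_univ_pi fun x => isCompact_Icc).of_isClosed_subset hcl hsub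

theorem nonneg_of_forall_states [IsOrderedModule ℝ X] (hArch : IsArchimedeanOVS X)
    (he : IsOrderUnit e) {x : X} (hx : ∀ f ∈ states e, 0 ≤ f x) : 0 ≤ x := by
  rcases eq_or_ne e 0 with rfl | he0
  · obtain ⟨c, -, h, -⟩ := he.2 x
    simpa using h
  have hpos : 0 < e := lt_of_le_of_ne he.1 he0.symm
  have key : ∀ ε : ℝ, 0 < ε → -x ≤ ε • e := by
    intro ε hε
    by_contra hcon
    -- Here `-x ≤ t • e` forces `ε ≤ t`, so `t • e ↦ t` extends to a state with value at least `ε`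
    -- at `-x`.
    obtain ⟨ψ, hψ, hψe, hψx⟩ := exists_positive_extension (LinearMap.toSpanSingleton ℝ X e)
      (fun y => by obtain ⟨c, -, -, h⟩ := he.2 y; exact ⟨c, h⟩) LinearMap.id
      (fun t ht => by
        change 0 ≤ t
        by_contra h
        have h1 : 0 ≤ t • e := ht
        have h2 : 0 ≤ (-t)⁻¹ • (t • e) :=
          smul_nonneg (inv_nonneg.2 (neg_nonneg.2 (not_le.1 h).le)) h1
        rw [smul_smul, inv_neg, neg_mul, inv_mul_cancel₀ (not_le.1 h).ne, neg_one_smul] at h2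
        exact absurd (neg_nonneg.1 h2) hpos.not_ge)
      (-x) ε (fun t ht => by
        by_contra h
        exact hcon (le_trans ht (smul_le_smul_of_nonneg_right (not_le.1 h).le he.1)))
    have h1 := hx ψ ⟨ψ, hψ, by simpa using hψe 1, rfl⟩
    rw [map_neg] at hψx
    linarith
  refine neg_nonpos.1 (hArch (-x) e fun n => ?_)
  rcases n.eq_zero_or_pos with rfl | hn
  · simpa using he.1
  have hn' : (0 : ℝ) < n := by exact_mod_cast hn
  have := smul_le_smul_of_nonneg_left (key (n : ℝ)⁻¹ (inv_pos.2 hn')) hn'.le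
  rwa [smul_smul, mul_inv_cancel₀ hn'.ne', one_smul, Nat.cast_smul_eq_nsmul] at this

theorem nonneg_of_forall_extremePoints_states [IsOrderedModule ℝ X] (hArch : IsArchimedeanOVS X)
    (he : IsOrderUnit e) {x : X} (hx : ∀ f ∈ (states e).extremePoints ℝ, 0 ≤ f x) : 0 ≤ x := by
  refine nonneg_of_forall_states hArch he fun f hf => ?_
  rw [← closure_convexHull_extremePoints (isCompact_states he) (convex_states e)] at hf
  have hconv : Convex ℝ {f : X → ℝ | 0 ≤ f x} :=
    convex_halfSpace_ge (LinearMap.proj x : (X → ℝ) →ₗ[ℝ] ℝ).isLinear 0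
  exact closure_minimal (convexHull_min hx hconv)
    (isClosed_le continuous_const (continuous_apply x)) hf

end States

/-! ### Evaluation on the closure of the pure states -/

section Evaluation

variable {X : Type*} [AddCommGroup X] [PartialOrder X] [IsOrderedAddMonoid X] [Module ℝ X] {e : X}

theorem closure_extremePoints_states_subset (he : IsOrderUnit e) :
    closure ((states e).extremePoints ℝ) ⊆ states e :=
  closure_minimal extremePoints_subset (isCompact_states he).isClosed

theorem compactSpace_closure_extremePoints_states (he : IsOrderUnit e) :
    CompactSpace (closure ((states e).extremePoints ℝ)) :=
  isCompact_iff_compactSpace.1 ((isCompact_states he).of_isClosed_subset isClosed_closure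
    (closure_extremePoints_states_subset he))

/-- The canonical representation of `X` by evaluation on the closure of the set of pure states. -/
def stateEvaluation (he : IsOrderUnit e) :
    X →ₗ[ℝ] C(closure ((states e).extremePoints ℝ), ℝ) where
  toFun x := ⟨fun ω => ω.1 x, (continuous_apply x).comp continuous_subtype_val⟩
  map_add' x y := by
    ext ω
    obtain ⟨φ, -, -, h⟩ := closure_extremePoints_states_subset he ω.2
    simp [← h]
  map_smul' c x := by
    ext ω
    obtain ⟨φ, -, -, h⟩ := closure_extremePoints_states_subset he ω.2
    simp [← h]

@[simp]
theorem stateEvaluation_apply (he : IsOrderUnit e) (x : X)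
    (ω : closure ((states e).extremePoints ℝ)) : stateEvaluation he x ω = ω.1 x := rfl

theorem stateEvaluation_unit (he : IsOrderUnit e) : stateEvaluation he e = 1 := by
  ext ω
  obtain ⟨φ, -, hφ, h⟩ := closure_extremePoints_states_subset he ω.2
  simp [← h, hφ]

theorem stateEvaluation_nonneg (he : IsOrderUnit e) {x : X} (hx : 0 ≤ x) :
    0 ≤ stateEvaluation he x := fun ω => by
  obtain ⟨φ, hφ, -, h⟩ := closure_extremePoints_states_subset he ω.2
  change 0 ≤ ω.1 x
  rw [← h]
  exact hφ x hx

theorem isBipositive_stateEvaluation [IsOrderedModule ℝ X] (hArch : IsArchimedeanOVS X)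
    (he : IsOrderUnit e) : IsBipositive (stateEvaluation he) := fun _ =>
  ⟨stateEvaluation_nonneg he, fun hx => nonneg_of_forall_extremePoints_states hArch he fun f hf =>
    hx ⟨f, subset_closure hf⟩⟩

theorem le_norm_smul_one {Ω : Type*} [TopologicalSpace Ω] [CompactSpace Ω] (f : C(Ω, ℝ)) :
    f ≤ ‖f‖ • (1 : C(Ω, ℝ)) := fun ω => by
  simpa using (le_abs_self _).trans (f.norm_coe_le_norm ω)

theorem abs_le_norm_of_positive {Ω : Type*} [TopologicalSpace Ω] [CompactSpace Ω]
    {ψ : C(Ω, ℝ) →ₗ[ℝ] ℝ} (hψ : ∀ f, 0 ≤ f → 0 ≤ ψ f) (h1 : ψ 1 = 1) (f : C(Ω, ℝ)) :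
    |ψ f| ≤ ‖f‖ := by
  have key : ∀ g : C(Ω, ℝ), ψ g ≤ ‖g‖ := fun g => by
    have := hψ _ (sub_nonneg.2 (le_norm_smul_one g))
    rw [map_sub, map_smul, h1, smul_eq_mul, mul_one] at this
    linarith
  refine abs_le'.2 ⟨key f, ?_⟩
  simpa using key (-f)

/-- A positive extension of a pure state is multiplicative against the elements of `X`. -/
theorem map_mul_of_mem_extremePoints (he : IsOrderUnit e)
    {ω : X → ℝ} (hω : ω ∈ (states e).extremePoints ℝ)
    {ψ : C(closure ((states e).extremePoints ℝ), ℝ) →ₗ[ℝ] ℝ} (hψ : ∀ f, 0 ≤ f → 0 ≤ ψ f)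
    (hext : ∀ x, ψ (stateEvaluation he x) = ω x)
    (h : C(closure ((states e).extremePoints ℝ), ℝ)) (x : X) :
    ψ (h * stateEvaluation he x) = ψ h * ω x := by
  have := compactSpace_closure_extremePoints_states he
  have h1 : ψ 1 = 1 := by
    obtain ⟨φ, -, hφ, rfl⟩ := hω.1
    rw [← stateEvaluation_unit he, hext, hφ]
  -- it suffices to treat functions with values in `[0, 1]` and of mean in `(0, 1)`
  have key : ∀ k : C(closure ((states e).extremePoints ℝ), ℝ), 0 ≤ k → k ≤ 1 →
      0 < ψ k → ψ k < 1 → ψ (k * stateEvaluation he x) = ψ k * ω x := by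
    intro k hk0 hk1 ha0 ha1
    have mem : ∀ g : C(closure ((states e).extremePoints ℝ), ℝ), 0 ≤ g → 0 < ψ g →
        (fun y => (ψ g)⁻¹ * ψ (g * stateEvaluation he y)) ∈ states e := by
      intro g hg hpos
      refine ⟨(ψ g)⁻¹ • (ψ ∘ₗ LinearMap.mulLeft ℝ g ∘ₗ stateEvaluation he), fun y hy => ?_, ?_, rfl⟩
      · exact mul_nonneg (inv_nonneg.2 hpos.le)
          (hψ _ fun η => mul_nonneg (hg η) (stateEvaluation_nonneg he hy η))
      · change (ψ g)⁻¹ * ψ (g * stateEvaluation he e) = 1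
        rw [stateEvaluation_unit, mul_one, inv_mul_cancel₀ hpos.ne']
    have hsub : ψ (1 - k) = 1 - ψ k := by rw [map_sub, h1]
    have hb0 : 0 < ψ (1 - k) := by rw [hsub]; linarith
    -- `ω` is the convex combination, with weights `ψ k` and `ψ (1 - k)`, of the states obtained by
    -- weighting `ψ` with `k` and `1 - k`; extremality identifies them with `ω`.
    have := hω.2 (mem k hk0 ha0) (mem (1 - k) (sub_nonneg.2 hk1) hb0)
      ⟨ψ k, ψ (1 - k), ha0, hb0, by rw [hsub]; ring, by
        ext y
        simp only [Pi.add_apply, Pi.smul_apply, smul_eq_mul]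
        rw [mul_inv_cancel_left₀ ha0.ne', mul_inv_cancel_left₀ hb0.ne', ← map_add, ← add_mul,
          add_sub_cancel, one_mul, hext]⟩
    have hx := congrFun this x
    rw [← hx, mul_inv_cancel_left₀ ha0.ne']
  set M : ℝ := ‖h‖ + 1 with hM
  have hMpos : 0 < M := by positivity
  have hval : ∀ η, |h η| ≤ M := fun η => (h.norm_coe_le_norm η).trans (by linarith)
  have hψh : |ψ h| ≤ M := (abs_le_norm_of_positive hψ h1 h).trans (by linarith)
  have hbd : ∀ t : ℝ, |t| ≤ M → |(4 * M)⁻¹ * t| ≤ 1 / 4 := fun t ht => by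
    rw [abs_mul, abs_of_pos (by positivity), mul_inv, mul_assoc, ← div_eq_inv_mul |t|]
    have : |t| / M ≤ 1 := (div_le_one hMpos).2 ht
    linarith
  -- The values and the mean of `1/2 + h/(4M)` lie in `[1/4, 3/4]`; the claim is affine in `h`, so
  -- it transfers back.
  have hk := key ((1 / 2 : ℝ) • 1 + (4 * M)⁻¹ • h)
    (fun η => by
      have := abs_le.1 (hbd _ (hval η))
      change 0 ≤ (1 / 2 : ℝ) * 1 + (4 * M)⁻¹ * h η
      linarith)
    (fun η => by
      have := abs_le.1 (hbd _ (hval η))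
      change (1 / 2 : ℝ) * 1 + (4 * M)⁻¹ * h η ≤ 1
      linarith)
    (by
      have := abs_le.1 (hbd _ hψh)
      rw [map_add, map_smul, map_smul, h1, smul_eq_mul, smul_eq_mul]
      linarith)
    (by
      have := abs_le.1 (hbd _ hψh)
      rw [map_add, map_smul, map_smul, h1, smul_eq_mul, smul_eq_mul]
      linarith)
  simp only [add_mul, smul_mul_assoc, one_mul, map_add, map_smul, h1, hext, smul_eq_mul,
    mul_one] at hk
  have : (4 * M)⁻¹ * ψ (h * stateEvaluation he x) = (4 * M)⁻¹ * (ψ h * ω x) := by linarith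
  exact mul_left_cancel₀ (by positivity) this

/-- The only positive extension of a pure state to `C(Ω, ℝ)` is point evaluation. -/
theorem eq_apply_of_mem_extremePoints (he : IsOrderUnit e)
    {ω : X → ℝ} (hω : ω ∈ (states e).extremePoints ℝ)
    {ψ : C(closure ((states e).extremePoints ℝ), ℝ) →ₗ[ℝ] ℝ} (hψ : ∀ f, 0 ≤ f → 0 ≤ ψ f)
    (hext : ∀ x, ψ (stateEvaluation he x) = ω x)
    (f : C(closure ((states e).extremePoints ℝ), ℝ)) : ψ f = f ⟨ω, subset_closure hω⟩ := by
  have := compactSpace_closure_extremePoints_states he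
  have h1 : ψ 1 = 1 := by
    obtain ⟨φ, -, hφ, rfl⟩ := hω.1
    rw [← stateEvaluation_unit he, hext, hφ]
  -- Quantifying over all `h` is what makes this set closed under products.
  let A : Subalgebra ℝ C(closure ((states e).extremePoints ℝ), ℝ) :=
    { carrier := {g | ∀ h, ψ (h * g) = ψ h * g ⟨ω, subset_closure hω⟩}
      mul_mem' := fun {a b} ha hb h => by
        rw [← mul_assoc, hb, ha, ContinuousMap.mul_apply, mul_assoc]
      add_mem' := fun {a b} ha hb h => by
        rw [mul_add, map_add, ha, hb, ContinuousMap.add_apply, mul_add]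
      algebraMap_mem' := fun r h => by
        rw [mul_comm, ← Algebra.smul_def, map_smul, smul_eq_mul, mul_comm]
        rfl }
  have hA : A.topologicalClosure = ⊤ := by
    refine ContinuousMap.subalgebra_topologicalClosure_eq_top_of_separatesPoints A ?_
    intro η ζ hne
    obtain ⟨x, hx⟩ := Function.ne_iff.1 (Subtype.coe_injective.ne hne)
    exact ⟨_, ⟨stateEvaluation he x, fun h => map_mul_of_mem_extremePoints he hω hψ hext h x, rfl⟩,
      hx⟩
  have hcont : Continuous ψ := AddMonoidHomClass.continuous_of_bound ψ 1 fun g => by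
    simpa using abs_le_norm_of_positive hψ h1 g
  have hcl : IsClosed {g | ψ g = g ⟨ω, subset_closure hω⟩} :=
    isClosed_eq hcont (continuous_eval_const _)
  refine closure_minimal (s := (A : Set C(closure ((states e).extremePoints ℝ), ℝ)))
    (fun g hg => ?_) hcl ?_
  · simpa [h1] using hg 1
  · have : f ∈ A.topologicalClosure := hA ▸ Algebra.mem_top
    exact this

theorem isOrderDense_range_stateEvaluation (he : IsOrderUnit e) :
    IsOrderDense (LinearMap.range (stateEvaluation he)) := by
  have := compactSpace_closure_extremePoints_states he
  refine fun f => ⟨fun d hd => hd.2, fun g hg => ?_⟩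
  have hmem : ∀ x, f ≤ stateEvaluation he x → g ≤ stateEvaluation he x := fun x hx =>
    hg ⟨⟨x, rfl⟩, hx⟩
  have hext : ∀ ω (hω : ω ∈ (states e).extremePoints ℝ),
      g ⟨ω, subset_closure hω⟩ ≤ f ⟨ω, subset_closure hω⟩ := by
    intro ω hω
    obtain ⟨φ, -, -, hφ⟩ := hω.1
    obtain ⟨ψ, hψ, hψi, hψf⟩ := exists_positive_extension (stateEvaluation he)
      (fun y => ⟨‖y‖ • e, by
        rw [map_smul, stateEvaluation_unit]
        exact le_norm_smul_one y⟩) φ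
      (fun x hx => by simpa [hφ] using hx ⟨ω, subset_closure hω⟩) f
      (g ⟨ω, subset_closure hω⟩)
      (fun x hx => by simpa [hφ] using hmem x hx ⟨ω, subset_closure hω⟩)
    rwa [eq_apply_of_mem_extremePoints he hω hψ (fun x => (hψi x).trans (congrFun hφ x)) f] at hψf
  intro η
  have hcl : IsClosed {η | g η ≤ f η} := isClosed_le g.continuous f.continuous
  refine closure_minimal (s := {η : closure ((states e).extremePoints ℝ) |
    η.1 ∈ (states e).extremePoints ℝ}) (fun ζ hζ => hext ζ.1 hζ) hcl ?_
  rw [closure_subtype]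
  convert η.2 using 2
  ext ω
  constructor
  · rintro ⟨ζ, hζ, rfl⟩
    exact hζ
  · exact fun hω => ⟨⟨ω, subset_closure hω⟩, hω, rfl⟩

end Evaluation

theorem mainTheorem4 {X : Type u} [AddCommGroup X] [PartialOrder X] [IsOrderedAddMonoid X]
    [Module ℝ X] [IsOrderedModule ℝ X]
    (hArch : IsArchimedeanOVS X) (hPre : IsPreRiesz X) (hUnit : ∃ e : X, IsOrderUnit e) :
    (∃ (Ω : Type u) (_ : TopologicalSpace Ω) (_ : CompactSpace Ω) (_ : T2Space Ω)
        (i : X →ₗ[ℝ] C(Ω, ℝ)), IsBipositive i ∧ IsOrderDense (LinearMap.range i)) ∧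
    (∀ (Ω : Type v) [TopologicalSpace Ω] [CompactSpace Ω] [T2Space Ω]
        [MeasurableSpace Ω] [BorelSpace Ω] (i : X →ₗ[ℝ] C(Ω, ℝ)),
        IsBipositive i → IsOrderDense (LinearMap.range i) →
        ∀ φ : X →ₗ[ℝ] ℝ, (∀ x : X, 0 ≤ x → 0 ≤ φ x) →
          ∃ μ : Measure Ω, μ.Regular ∧ ∀ x : X, φ x = ∫ ω, i x ω ∂μ) := by
  -- `hPre` is not needed: an Archimedean space with an order unit is automatically pre-Riesz.
  obtain ⟨e, he⟩ := hUnit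
  refine ⟨⟨closure ((states e).extremePoints ℝ), inferInstance,
    compactSpace_closure_extremePoints_states he, inferInstance, stateEvaluation he,
    isBipositive_stateEvaluation hArch he, isOrderDense_range_stateEvaluation he⟩, ?_⟩
  intro Ω _ _ _ _ _ i hi hD φ hφ
  obtain ⟨ψ, hψ, hψi, -⟩ := exists_positive_extension i
    (fun f => by
      obtain ⟨_, ⟨x, rfl⟩, hx⟩ := hD.exists_le f
      exact ⟨x, hx⟩) φ (fun x hx => hφ x ((hi x).2 hx)) 0 0
    (fun x hx => hφ x ((hi x).2 hx))
  obtain ⟨μ, hμ, h⟩ := exists_regular_measure_of_positive ψ hψ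
  exact ⟨μ, hμ, fun x => (hψi x).symm.trans (h (i x))⟩
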